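/- Let $S_{p,q}$ be the orientation of a star on $p+q+1$ vertices whose center has indegree $p$ and outdegree $q$. Directed graphs have no loops, but two vertices may be joined by edges in both directions; $e(G)$ is the number of edges of $G$. A collection $G_1,\dots,G_c$ of directed graphs on a common vertex set contains a rainbow $S_{p,q}$ if there are a copy of $S_{p,q}$ on this vertex set and pairwise distinct colors $i_e\in\{1,\dots,c\}$, one for each edge $e$ of the copy, with $e\in E(G_{i_e})$ for every $e$. Let $q\ge p\ge 1$ and $c\ge p+q$ be integers. The values $$t_1=2p+q-1,\qquad t_2=\begin{cases}\dfrac{(q-1)(p+q-1)}{q-p-1}&\text{if }q\ge p+2,\\ \infty&\text{if }q\le p+1,\end{cases}$$ $$t_3=p+q-1+\sqrt{pq},\qquad t_4=q-1+\sqrt{(q-1)(q-p)}$$ satisfy $t_1\le t_2$, $t_1\le t_3$, and either $t_2\le t_3\le t_4$ or $t_4\le t_3\le t_2$. Moreover, every collection of directed graphs $G_1,\dots,G_c$ on a common set of $n$ vertices containing no rainbow $S_{p,q}$ satisfies the following. If $t_2\le t_3\le t_4$, then $$\min_{1\le i\le c}e(G_i)\le\begin{cases} \dfrac{(p+q-1)^2}{c^2}\,n^2+o(n^2)&\text{if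 }c\le t_1,\\[6pt] \dfrac{(c-q+1)^2(p+q-1)^2}{4c^2p(c-p-q+1)}\,n^2+o(n^2)&\text{if }t_1\le c\le t_2,\\[6pt] \dfrac{q-1}{c}\,n^2+o(n^2)&\text{if }t_2\le c\le t_4,\\[6pt] \dfrac{(c^2-(p-1)(q-1))^2}{4c^2(c-p+1)(c-q+1)}\,n^2+o(n^2)&\text{if }c\ge t_4. \end{cases}$$ If $t_4\le t_3\le t_2$, then $$\min_{1\le i\le c}e(G_i)\le\begin{cases} \dfrac{(p+q-1)^2}{c^2}\,n^2+o(n^2)&\text{if }c\le t_1,\\[6pt] \dfrac{(c-q+1)^2(p+q-1)^2}{4c^2p(c-p-q+1)}\,n^2+o(n^2)&\text{if }t_1\le c\le t_3,\\[6pt] \dfrac{(c^2-(p-1)(q-1))^2}{4c^2(c-p+1)(c-q+1)}\,n^2+o(n^2)&\text{if }c\ge t_3. \end{cases}$$ Here the $o(n^2)$ terms depend only on $p$, $q$, $c$ and $n$, and are taken as $n\to\infty$ with $p,q,c$ fixed. All these bounds are tight up to a lower order error term: in each case, with $b\,n^2$ the main term of the bound, for every $n$ there is a collection of $c$ directed graphs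 on $n$ vertices containing no rainbow $S_{p,q}$ with $\min_{1\le i\le c}e(G_i)\ge b\,n^2-o(n^2)$. -/

import Mathlib

open Asymptotics Filter

namespace RainbowStar

/-- A simple directed graph is a digraph without loops; a pair of vertices may be joined by an
edge in each of the two directions. -/
def Loopless {V : Type*} (G : Digraph V) : Prop :=
  ∀ v, ¬ G.Adj v v

/-- The set of (directed) edges of a digraph. -/
def edgeSet {V : Type*} (G : Digraph V) : Set (V × V) :=
  {e | G.Adj e.1 e.2}

/-- The number `e(G)` of edges of a digraph. -/
noncomputable def edgeCount {V : Type*} (G : Digraph V) : ℕ :=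
  (edgeSet G).ncard

/-- The minimum number of edges of a graph in the collection `G_1, …, G_c`
(the collection is nonempty wherever this is used). -/
noncomputable def minEdges {V : Type*} {c : ℕ} (G : Fin c → Digraph V) : ℕ :=
  ⨅ i, edgeCount (G i)

/-- The star `S_{p,q}` on `p + q + 1` vertices: the center `none` receives an edge from each of
`p` leaves and sends an edge to each of the other `q` leaves. -/
def star (p q : ℕ) : Digraph (Option (Fin p ⊕ Fin q)) where
  Adj u v :=
    (∃ i : Fin p, u = some (Sum.inl i) ∧ v = none) ∨
    (∃ j : Fin q, u = none ∧ v = some (Sum.inr j))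

/-- The collection `G` contains a rainbow copy of `F`: there is a copy of `F` on the common vertex
set (an injective map of the vertices), whose edges can be assigned pairwise different colors
such that each edge belongs to the graph of its color. -/
def ContainsRainbow {W V : Type*} {c : ℕ} (F : Digraph W) (G : Fin c → Digraph V) : Prop :=
  ∃ (f : W ↪ V) (φ : edgeSet F ↪ Fin c),
    ∀ e : edgeSet F, (G (φ e)).Adj (f e.1.1) (f e.1.2)

/-- `G` is a collection of simple directed graphs containing no rainbow `S_{p,q}`. -/
def RainbowStarFree {V : Type*} {c : ℕ} (p q : ℕ) (G : Fin c → Digraph V) : Prop :=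
  (∀ i, Loopless (G i)) ∧ ¬ ContainsRainbow (star p q) G

/-- Every collection of `c` digraphs on `n` vertices without a rainbow `S_{p,q}` satisfies
`min e(G_i) ≤ b n² + o(n²)`. The error term depends only on `p`, `q`, `c` and `n`. -/
def UpperBound (p q c : ℕ) (b : ℝ) : Prop :=
  ∃ err : ℕ → ℝ, err =o[atTop] (fun n : ℕ => (n : ℝ) ^ 2) ∧
    ∀ (n : ℕ) (G : Fin c → Digraph (Fin n)), RainbowStarFree p q G →
      (minEdges G : ℝ) ≤ b * (n : ℝ) ^ 2 + err n

/-- For every `n` there is a collection of `c` digraphs on `n` vertices without a rainbow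
`S_{p,q}` such that `min e(G_i) ≥ b n² - o(n²)`. -/
def TightBound (p q c : ℕ) (b : ℝ) : Prop :=
  ∃ err : ℕ → ℝ, err =o[atTop] (fun n : ℕ => (n : ℝ) ^ 2) ∧
    ∀ n : ℕ, ∃ G : Fin c → Digraph (Fin n), RainbowStarFree p q G ∧
      b * (n : ℝ) ^ 2 - err n ≤ (minEdges G : ℝ)

/-- `min e(G_i) ≤ b n² + o(n²)`, and this is tight up to a lower order error term. -/
def AsymptoticallyTightBound (p q c : ℕ) (b : ℝ) : Prop :=
  UpperBound p q c b ∧ TightBound p q c b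

/-- `t₁ = 2p + q - 1`. -/
noncomputable def t₁ (p q : ℕ) : EReal :=
  ((2 * p + q - 1 : ℝ) : EReal)

/-- `t₂ = (q-1)(p+q-1)/(q-p-1)` if `q ≥ p + 2`, and `t₂ = ∞` if `q ≤ p + 1`. -/
noncomputable def t₂ (p q : ℕ) : EReal :=
  if p + 2 ≤ q then ((((q : ℝ) - 1) * (p + q - 1) / (q - p - 1) : ℝ) : EReal) else ⊤

/-- `t₃ = p + q - 1 + √(pq)`. -/
noncomputable def t₃ (p q : ℕ) : EReal :=
  ((p + q - 1 + √((p : ℝ) * q) : ℝ) : EReal)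

/-- `t₄ = q - 1 + √((q-1)(q-p))`. -/
noncomputable def t₄ (p q : ℕ) : EReal :=
  ((q - 1 + √(((q : ℝ) - 1) * (q - p)) : ℝ) : EReal)

/-- `(p+q-1)² / c²`. -/
noncomputable def bound₁ (p q c : ℕ) : ℝ :=
  ((p : ℝ) + q - 1) ^ 2 / (c : ℝ) ^ 2

/-- `(c-q+1)² (p+q-1)² / (4 c² p (c-p-q+1))`. -/
noncomputable def bound₂ (p q c : ℕ) : ℝ :=
  ((c : ℝ) - q + 1) ^ 2 * ((p : ℝ) + q - 1) ^ 2 / (4 * (c : ℝ) ^ 2 * p * ((c : ℝ) - p - q + 1))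

/-- `(q-1) / c`. -/
noncomputable def bound₃ (q c : ℕ) : ℝ :=
  ((q : ℝ) - 1) / c

/-- `(c² - (p-1)(q-1))² / (4 c² (c-p+1) (c-q+1))`. -/
noncomputable def bound₄ (p q c : ℕ) : ℝ :=
  ((c : ℝ) ^ 2 - ((p : ℝ) - 1) * ((q : ℝ) - 1)) ^ 2 /
    (4 * (c : ℝ) ^ 2 * ((c : ℝ) - p + 1) * ((c : ℝ) - q + 1))

end RainbowStar

/-!
The problem reduces to maximising a product of two linear forms over a triangle.

In a collection of digraphs, give each vertex the profile `(I, O)`, where `I` and `O` are the sets of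
colours in which its in-degree, respectively its out-degree, is at least `p + q`. Distinct
leaves can then be chosen in these colours, so without a rainbow `S_{p,q}` Hall's condition for disjoint colour
sets of sizes `p` and `q` fails: `|I| < p`, or `|O| < q`, or `|I ∪ O| < p + q`
(`admissible_of_rainbowStarFree`). Up to `O(n)` edges, `e(G_i)` is at most `X_i Y_i`, where `X_i` and
`Y_i` count the vertices with `i ∈ O` and with `i ∈ I`. Conversely any distribution of such profiles
is realised by joining all vertices with `i ∈ O` to all vertices with `i ∈ I` in colour `i`
(`tightBound_of_profiles`).

The possible values of `(|O|, |I|)` are dominated by the three points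
`A = (c, p - 1)`, `B = (q - 1, c)` and `C = (p + q - 1, p + q - 1)`.
If `α x + β y ≤ M` holds at these points, then the average over `i` of `α X_i + β Y_i` is at most
`M n / c`, so `X_i Y_i ≤ M² n² / (4 α β c²)` for some `i` (`upperBound_of_linear_le`). Using all
cyclic shifts of the colours equally often, every point `(x, y)` of the triangle `ABC` yields
collections with all `e(G_i) ≥ x y n² / c² - O(n)` (`tightBound_of_weights`).

Hence the answer is the maximum of `x y / c²` over the triangle. It is attained at `C`, inside `BC`,
at `B`, or inside `AB`, which gives the four bounds: `t₁` and `t₂` are where the maximum on the line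
`BC` leaves the segment at `C` and at `B`, `t₄` is where the maximum on the line `AB` leaves the
segment at `B`, and `t₃` is where `A`, `B` and `C` are collinear.
-/

namespace RainbowStar

/-! ### Colour profiles of a vertex -/

/-- The pair `(I, O)` of colour sets does not allow a choice of `p` colours from `I` and `q` further
colours from `O`: a violated Hall condition. Here `I` and `O` stand for the colours in which a
vertex has many in-neighbours and many out-neighbours. -/
def Admissible {c : ℕ} (p q : ℕ) (I O : Finset (Fin c)) : Prop :=
  I.card < p ∨ O.card < q ∨ (I ∪ O).card < p + q

theorem exists_disjoint_subsets_card {α : Type*} [DecidableEq α] {p q : ℕ} {I O : Finset α}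
    (hI : p ≤ I.card) (hO : q ≤ O.card) (hunion : p + q ≤ (I ∪ O).card) :
    ∃ P Q : Finset α, P ⊆ I ∧ Q ⊆ O ∧ Disjoint P Q ∧ P.card = p ∧ Q.card = q := by
  rcases le_total p (I \ O).card with h | h
  · obtain ⟨P, hP, hPc⟩ := Finset.exists_subset_card_eq h
    obtain ⟨Q, hQ, hQc⟩ := Finset.exists_subset_card_eq hO
    exact ⟨P, Q, hP.trans Finset.sdiff_subset, hQ,
      Finset.disjoint_of_subset_left hP (Finset.disjoint_of_subset_right hQ
        Finset.sdiff_disjoint), hPc, hQc⟩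
  · -- `P` exhausts `I \ O`, so that `O \ P = (I ∪ O) \ P` is as large as possible.
    obtain ⟨P, hP, hPI, hPc⟩ := Finset.exists_subsuperset_card_eq Finset.sdiff_subset h hI
    have hcard : q ≤ (O \ P).card := by
      have h1 : I ∪ O ⊆ P ∪ (O \ P) := by
        intro x hx
        by_cases hxO : x ∈ O
        · by_cases hxP : x ∈ P <;> simp [hxO, hxP]
        · have hxI : x ∈ I := by simpa [hxO] using hx
          exact Finset.mem_union_left _ (hP (by simp [hxI, hxO]))
      have h2 := (Finset.card_le_card h1).trans (Finset.card_union_le _ _)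
      omega
    obtain ⟨Q, hQ, hQc⟩ := Finset.exists_subset_card_eq hcard
    exact ⟨P, Q, hPI, hQ.trans Finset.sdiff_subset,
      Finset.disjoint_of_subset_right hQ Finset.disjoint_sdiff, hPc, hQc⟩

/-- The leaf of an edge of the star determines the edge. -/
theorem exists_leaf_of_edge {p q : ℕ} (e : edgeSet (star p q)) :
    ∃ s : Fin p ⊕ Fin q,
      (e : Option (Fin p ⊕ Fin q) × Option (Fin p ⊕ Fin q)) =
        Sum.elim (fun i => (some (Sum.inl i), none)) (fun j => (none, some (Sum.inr j))) s := by
  obtain ⟨⟨u, v⟩, h⟩ := e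
  rcases h with ⟨i, h1, h2⟩ | ⟨j, h1, h2⟩
  · exact ⟨Sum.inl i, by simp only at h1 h2; simp [h1, h2]⟩
  · exact ⟨Sum.inr j, by simp only at h1 h2; simp [h1, h2]⟩

/-- A rainbow star is found by giving its center, its leaves and the colours of its edges. -/
theorem containsRainbow_star_of_leaves {V : Type*} {c p q : ℕ} {G : Fin c → Digraph V} (v : V)
    (l : Fin p ⊕ Fin q → V) (χ : Fin p ⊕ Fin q → Fin c) (hl : Function.Injective l)
    (hlv : ∀ s, l s ≠ v) (hχ : Function.Injective χ)
    (hin : ∀ i, (G (χ (Sum.inl i))).Adj (l (Sum.inl i)) v)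
    (hout : ∀ j, (G (χ (Sum.inr j))).Adj v (l (Sum.inr j))) :
    ContainsRainbow (star p q) G := by
  choose leaf hleaf using exists_leaf_of_edge (p := p) (q := q)
  refine ⟨⟨fun o => o.elim v l, ?_⟩, ⟨fun e => χ (leaf e), ?_⟩, ?_⟩
  · intro o o' h
    cases o <;> cases o' <;> simp at h
    · rfl
    · exact absurd h.symm (hlv _)
    · exact absurd h (hlv _)
    · rw [hl h]
  · intro e e' h
    exact Subtype.ext ((hleaf e).trans ((congrArg _ (hχ h)).trans (hleaf e').symm))
  · intro e
    have he := hleaf e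
    change (G (χ (leaf e))).Adj (Option.elim e.1.1 v l) (Option.elim e.1.2 v l)
    rw [he]
    cases leaf e with
    | inl i => exact hin i
    | inr j => exact hout j

/-- If a vertex has at least `p + q` in-neighbours in every colour of `I` and at least `p + q`
out-neighbours in every colour of `O`, then distinct leaves can be chosen once disjoint sets of
colours are, so in a collection without a rainbow star the profile `(I, O)` is admissible. -/
theorem admissible_of_rainbowStarFree {V : Type*} {c p q : ℕ}
    {G : Fin c → Digraph V} (hG : RainbowStarFree p q G) (v : V)
    (Nin Nout : Fin c → Finset V) (I O : Finset (Fin c))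
    (hNin : ∀ i u, u ∈ Nin i → (G i).Adj u v) (hNout : ∀ i u, u ∈ Nout i → (G i).Adj v u)
    (hI : ∀ i ∈ I, p + q ≤ (Nin i).card) (hO : ∀ i ∈ O, p + q ≤ (Nout i).card) :
    Admissible p q I O := by
  classical
  by_contra hadm
  simp only [Admissible, not_or, not_lt] at hadm
  obtain ⟨P, Q, hP, hQ, hPQ, hPc, hQc⟩ :=
    exists_disjoint_subsets_card hadm.1 hadm.2.1 hadm.2.2
  let χ : Fin p ⊕ Fin q → Fin c :=
    Sum.elim (P.orderEmbOfFin hPc) (Q.orderEmbOfFin hQc)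
  have hχ : Function.Injective χ := by
    refine Function.Injective.sumElim (P.orderEmbOfFin hPc).injective
      (Q.orderEmbOfFin hQc).injective ?_
    intro i j hij
    exact Finset.disjoint_left.1 hPQ (Finset.orderEmbOfFin_mem P hPc i)
      (hij ▸ Finset.orderEmbOfFin_mem Q hQc j)
  let N : Fin p ⊕ Fin q → Finset V := Sum.elim (fun i => Nin (χ (Sum.inl i)))
    (fun j => Nout (χ (Sum.inr j)))
  have hN : ∀ s, p + q ≤ (N s).card := by
    rintro (i | j)
    · exact hI _ (hP (Finset.orderEmbOfFin_mem P hPc i))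
    · exact hO _ (hQ (Finset.orderEmbOfFin_mem Q hQc j))
  -- Hall's condition holds since each of the `p + q` sets `N s` has at least `p + q` elements.
  obtain ⟨l, hl, hlN⟩ := (Finset.all_card_le_biUnion_card_iff_exists_injective N).1 (by
    intro S
    rcases S.eq_empty_or_nonempty with rfl | ⟨s, hs⟩
    · simp
    · calc S.card ≤ Fintype.card (Fin p ⊕ Fin q) := S.card_le_univ
        _ = p + q := by simp
        _ ≤ (N s).card := hN s
        _ ≤ (S.biUnion N).card := Finset.card_le_card (Finset.subset_biUnion_of_mem N hs))
  have hin : ∀ i, (G (χ (Sum.inl i))).Adj (l (Sum.inl i)) v :=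
    fun i => hNin _ _ (hlN (Sum.inl i))
  have hout : ∀ j, (G (χ (Sum.inr j))).Adj v (l (Sum.inr j)) :=
    fun j => hNout _ _ (hlN (Sum.inr j))
  refine hG.2 (containsRainbow_star_of_leaves v l χ hl ?_ hχ hin hout)
  rintro (i | j) h
  · exact hG.1 _ v (h ▸ hin i)
  · have := hout j
    rw [h] at this
    exact hG.1 _ v this

/-- Conversely, a rainbow star yields colours violating admissibility at its center. -/
theorem not_containsRainbow_star_of_admissible {V : Type*} {c p q : ℕ} {G : Fin c → Digraph V}
    (I O : V → Finset (Fin c)) (hadm : ∀ v, Admissible p q (I v) (O v))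
    (hin : ∀ i u v, (G i).Adj u v → i ∈ I v) (hout : ∀ i u v, (G i).Adj u v → i ∈ O u) :
    ¬ ContainsRainbow (star p q) G := by
  classical
  rintro ⟨f, φ, hφ⟩
  let e : Fin p ⊕ Fin q → edgeSet (star p q) := Sum.elim
    (fun i => ⟨(some (Sum.inl i), none), Or.inl ⟨i, rfl, rfl⟩⟩)
    (fun j => ⟨(none, some (Sum.inr j)), Or.inr ⟨j, rfl, rfl⟩⟩)
  have he : Function.Injective e := by
    rintro (i | j) (i' | j') h <;> simpa [e] using congrArg Subtype.val h
  have hI : ∀ i, φ (e (Sum.inl i)) ∈ I (f none) := fun i => hin _ _ _ (hφ (e (Sum.inl i)))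
  have hO : ∀ j, φ (e (Sum.inr j)) ∈ O (f none) := fun j => hout _ _ _ (hφ (e (Sum.inr j)))
  have hinj : Function.Injective fun s => φ (e s) := φ.injective.comp he
  have h1 : p ≤ (I (f none)).card := by
    simpa using Finset.card_le_card_of_injOn (s := Finset.univ) (fun i : Fin p => φ (e (Sum.inl i)))
      (fun i _ => hI i) (hinj.comp Sum.inl_injective).injOn
  have h2 : q ≤ (O (f none)).card := by
    simpa using Finset.card_le_card_of_injOn (s := Finset.univ) (fun j : Fin q => φ (e (Sum.inr j)))
      (fun j _ => hO j) (hinj.comp Sum.inr_injective).injOn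
  have h3 : p + q ≤ (I (f none) ∪ O (f none)).card := by
    simpa using Finset.card_le_card_of_injOn (s := Finset.univ)
      (fun s : Fin p ⊕ Fin q => φ (e s))
      (by rintro (i | j) _
          · exact Finset.mem_coe.2 (Finset.mem_union_left _ (hI i))
          · exact Finset.mem_coe.2 (Finset.mem_union_right _ (hO j))) hinj.injOn
  rcases hadm (f none) with h | h | h <;> omega

/-! ### Upper bounds -/

theorem isLittleO_const_mul_natCast_sq (C : ℝ) :
    (fun n : ℕ => C * (n : ℝ)) =o[atTop] (fun n : ℕ => (n : ℝ) ^ 2) := by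
  have h : (fun x : ℝ => x ^ 1) =o[atTop] (fun x : ℝ => x ^ 2) :=
    isLittleO_pow_pow_atTop_of_lt (by norm_num)
  simpa [Function.comp_def] using (h.comp_tendsto tendsto_natCast_atTop_atTop).const_mul_left C

theorem card_le_mul_add_of_sparse {V : Type*} [Fintype V] [DecidableEq V] (E : Finset (V × V))
    (A B : Finset V) (D : ℕ)
    (hA : ∀ u ∉ A, (E.filter (fun e => e.1 = u)).card ≤ D)
    (hB : ∀ v ∉ B, (E.filter (fun e => e.2 = v)).card ≤ D) :
    E.card ≤ A.card * B.card + 2 * D * Fintype.card V := by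
  have hsub : E ⊆ A ×ˢ B ∪ (E.filter (fun e => e.1 ∉ A) ∪ E.filter (fun e => e.2 ∉ B)) := by
    intro e he
    simp only [Finset.mem_union, Finset.mem_product, Finset.mem_filter]
    tauto
  have h1 : (E.filter (fun e => e.1 ∉ A)).card ≤ D * Fintype.card V := by
    refine Finset.card_le_mul_card_image_of_maps_to (f := Prod.fst) (t := Finset.univ)
      (fun _ _ => Finset.mem_univ _) D ?_
    intro u _
    by_cases hu : u ∈ A
    · rw [Finset.filter_eq_empty_iff.2]
      · simp
      · intro e he heu
        exact (Finset.mem_filter.1 he).2 (heu ▸ hu)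
    · refine (Finset.card_le_card ?_).trans (hA u hu)
      exact Finset.filter_subset_filter _ (Finset.filter_subset _ _)
  have h2 : (E.filter (fun e => e.2 ∉ B)).card ≤ D * Fintype.card V := by
    refine Finset.card_le_mul_card_image_of_maps_to (f := Prod.snd) (t := Finset.univ)
      (fun _ _ => Finset.mem_univ _) D ?_
    intro u _
    by_cases hu : u ∈ B
    · rw [Finset.filter_eq_empty_iff.2]
      · simp
      · intro e he heu
        exact (Finset.mem_filter.1 he).2 (heu ▸ hu)
    · refine (Finset.card_le_card ?_).trans (hB u hu)
      exact Finset.filter_subset_filter _ (Finset.filter_subset _ _)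
  calc E.card ≤ _ := Finset.card_le_card hsub
    _ ≤ (A ×ˢ B).card + ((E.filter (fun e => e.1 ∉ A)).card +
        (E.filter (fun e => e.2 ∉ B)).card) :=
      (Finset.card_union_le _ _).trans (Nat.add_le_add_left (Finset.card_union_le _ _) _)
    _ ≤ A.card * B.card + 2 * D * Fintype.card V := by
      rw [Finset.card_product]
      linarith

/-- The degrees of a graph in a rainbow-star-free collection are governed by admissible profiles,
up to a linear number of edges. -/
theorem exists_profiles_of_rainbowStarFree {n c p q : ℕ} {G : Fin c → Digraph (Fin n)}
    (hG : RainbowStarFree p q G) :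
    ∃ I O : Fin n → Finset (Fin c), (∀ v, Admissible p q (I v) (O v)) ∧
      ∀ i, edgeCount (G i) ≤ (Finset.univ.filter (fun v => i ∈ O v)).card *
        (Finset.univ.filter (fun v => i ∈ I v)).card + 2 * (p + q) * n := by
  classical
  let Nin : Fin c → Fin n → Finset (Fin n) := fun i v => Finset.univ.filter fun u => (G i).Adj u v
  let Nout : Fin c → Fin n → Finset (Fin n) := fun i v => Finset.univ.filter fun u => (G i).Adj v u
  refine ⟨fun v => Finset.univ.filter fun i => p + q ≤ (Nin i v).card,
    fun v => Finset.univ.filter fun i => p + q ≤ (Nout i v).card, fun v => ?_, fun i => ?_⟩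
  · refine admissible_of_rainbowStarFree hG v (fun i => Nin i v) (fun i => Nout i v) _ _
      ?_ ?_ ?_ ?_ <;> simp [Nin, Nout]
  · have hE : edgeCount (G i) =
        (Finset.univ.filter fun e : Fin n × Fin n => (G i).Adj e.1 e.2).card := by
      rw [edgeCount, ← Set.ncard_coe_finset]
      congr 1
      ext e
      simp [edgeSet]
    rw [hE]
    refine (card_le_mul_add_of_sparse _ (Finset.univ.filter fun v => p + q ≤ (Nout i v).card)
      (Finset.univ.filter fun v => p + q ≤ (Nin i v).card) (p + q) ?_ ?_).trans (by simp)
    · intro u hu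
      have hu' : (Nout i u).card < p + q := by simpa using hu
      refine le_trans ?_ hu'.le
      refine Finset.card_le_card_of_injOn Prod.snd ?_ ?_
      · rintro ⟨x, y⟩ h
        simp only [Finset.coe_filter, Finset.mem_filter, Finset.mem_univ, true_and,
          Set.mem_ofPred_eq] at h
        obtain ⟨h, rfl⟩ := h
        simpa [Nout] using h
      · rintro ⟨x, y⟩ h ⟨x', y'⟩ h' hy
        simp only [Finset.coe_filter, Set.mem_ofPred_eq] at h h' hy
        rw [h.2, h'.2, hy]
    · intro v hv
      have hv' : (Nin i v).card < p + q := by simpa using hv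
      refine le_trans ?_ hv'.le
      refine Finset.card_le_card_of_injOn Prod.fst ?_ ?_
      · rintro ⟨x, y⟩ h
        simp only [Finset.coe_filter, Finset.mem_filter, Finset.mem_univ, true_and,
          Set.mem_ofPred_eq] at h
        obtain ⟨h, rfl⟩ := h
        simpa [Nin] using h
      · rintro ⟨x, y⟩ h ⟨x', y'⟩ h' hy
        simp only [Finset.coe_filter, Set.mem_ofPred_eq] at h h' hy
        rw [h.2, h'.2, hy]

/-- A linear functional that is at most `M` at the three extreme profiles is at most `M` at every
admissible profile. -/
theorem Admissible.linear_le {c p q : ℕ} {I O : Finset (Fin c)} (h : Admissible p q I O)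
    {α β M : ℝ} (hα : 0 ≤ α) (hβ : 0 ≤ β)
    (hA : α * c + β * (p - 1) ≤ M) (hB : α * (q - 1) + β * c ≤ M)
    (hC : (α + β) * (p + q - 1) ≤ M) :
    α * O.card + β * I.card ≤ M := by
  have hIc : (I.card : ℝ) ≤ c := by exact_mod_cast (Finset.card_le_univ I).trans (by simp)
  have hOc : (O.card : ℝ) ≤ c := by exact_mod_cast (Finset.card_le_univ O).trans (by simp)
  rcases h with h | h | h
  · have h' : (I.card : ℝ) + 1 ≤ p := by exact_mod_cast h
    nlinarith [mul_le_mul_of_nonneg_left hOc hα, mul_le_mul_of_nonneg_left h' hβ]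
  · have h' : (O.card : ℝ) + 1 ≤ q := by exact_mod_cast h
    nlinarith [mul_le_mul_of_nonneg_left hIc hβ, mul_le_mul_of_nonneg_left h' hα]
  · have h1 : (I.card : ℝ) + 1 ≤ p + q := by
      have := Finset.card_le_card (Finset.subset_union_left (s₁ := I) (s₂ := O))
      exact_mod_cast (by omega : I.card + 1 ≤ p + q)
    have h2 : (O.card : ℝ) + 1 ≤ p + q := by
      have := Finset.card_le_card (Finset.subset_union_right (s₁ := I) (s₂ := O))
      exact_mod_cast (by omega : O.card + 1 ≤ p + q)
    nlinarith [mul_le_mul_of_nonneg_left h1 hβ, mul_le_mul_of_nonneg_left h2 hα]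

/-- If `α x + β y ≤ M` at the three extreme profiles, then averaging over the colours gives a colour
with `α X + β Y ≤ M n / c`, where `X` and `Y` count the vertices having it as out-colour and
in-colour, and `X Y` is bounded by the inequality of arithmetic and geometric means. -/
theorem upperBound_of_linear_le {p q c : ℕ} (hc : 0 < c) {α β M : ℝ} (hα : 0 < α) (hβ : 0 < β)
    (hA : α * c + β * (p - 1) ≤ M) (hB : α * (q - 1) + β * c ≤ M)
    (hC : (α + β) * (p + q - 1) ≤ M) :
    UpperBound p q c (M ^ 2 / (4 * α * β * (c : ℝ) ^ 2)) := by
  refine ⟨fun n => (2 * (p + q) : ℝ) * n, isLittleO_const_mul_natCast_sq _, fun n G hG => ?_⟩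
  obtain ⟨I, O, hadm, hE⟩ := exists_profiles_of_rainbowStarFree hG
  have hc' : (0 : ℝ) < c := by exact_mod_cast hc
  let X : Fin c → ℝ := fun i => ((Finset.univ.filter (fun v => i ∈ O v)).card : ℝ)
  let Y : Fin c → ℝ := fun i => ((Finset.univ.filter (fun v => i ∈ I v)).card : ℝ)
  have double : ∀ S : Fin n → Finset (Fin c),
      ∑ i, ((Finset.univ.filter (fun v => i ∈ S v)).card : ℝ) = ∑ v, ((S v).card : ℝ) := by
    intro S
    have h := Finset.sum_card_bipartiteAbove_eq_sum_card_bipartiteBelow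
      (s := (Finset.univ : Finset (Fin c))) (t := (Finset.univ : Finset (Fin n)))
      (fun i v => i ∈ S v)
    simp only [Finset.bipartiteAbove, Finset.bipartiteBelow, Finset.filter_univ_mem] at h
    exact_mod_cast h
  have hsum : ∑ i, (α * X i + β * Y i) ≤ ∑ _i : Fin c, M * n / c := by
    have h1 : ∑ i, (α * X i + β * Y i) = ∑ v, (α * (O v).card + β * (I v).card) := by
      rw [Finset.sum_add_distrib, Finset.sum_add_distrib, ← Finset.mul_sum, ← Finset.mul_sum,
        ← Finset.mul_sum, ← Finset.mul_sum, double O, double I]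
    have h2 : ∑ v, (α * ((O v).card : ℝ) + β * (I v).card) ≤ ∑ _v : Fin n, M :=
      Finset.sum_le_sum fun v _ => (hadm v).linear_le hα.le hβ.le hA hB hC
    rw [h1]
    refine h2.trans (le_of_eq ?_)
    simp only [Finset.sum_const, Finset.card_univ, Fintype.card_fin, nsmul_eq_mul]
    field_simp
  have : Nonempty (Fin c) := ⟨⟨0, hc⟩⟩
  obtain ⟨i, -, hi⟩ := Finset.exists_le_of_sum_le Finset.univ_nonempty hsum
  have hmin : (minEdges G : ℝ) ≤ X i * Y i + 2 * (p + q) * n := by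
    have h1 : minEdges G ≤ edgeCount (G i) := ciInf_le (OrderBot.bddBelow _) i
    have h2 := h1.trans (hE i)
    simp only [X, Y]
    exact_mod_cast h2
  have hX : 0 ≤ X i := Nat.cast_nonneg _
  have hY : 0 ≤ Y i := Nat.cast_nonneg _
  have hprod : X i * Y i ≤ M ^ 2 / (4 * α * β * (c : ℝ) ^ 2) * (n : ℝ) ^ 2 := by
    have h1 : (α * X i + β * Y i) ^ 2 ≤ (M * n / c) ^ 2 := by
      apply pow_le_pow_left₀ (by positivity) hi
    have h2 : 4 * (α * X i) * (β * Y i) ≤ (M * n / c) ^ 2 := by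
      nlinarith [sq_nonneg (α * X i - β * Y i)]
    have h3 : M ^ 2 / (4 * α * β * (c : ℝ) ^ 2) * (n : ℝ) ^ 2 = (M * n / c) ^ 2 / (4 * α * β) := by
      field_simp
    rw [h3, le_div_iff₀ (by positivity)]
    linarith
  linarith

/-! ### Constructions -/

/-- Vertices can be distributed over finitely many classes with prescribed densities, losing at
most one vertex in each class. -/
theorem exists_map_card_fiber_ge {T : Type*} [Fintype T] [DecidableEq T] [Nonempty T] (w : T → ℝ)
    (hw : ∀ t, 0 ≤ w t) (hsum : ∑ t, w t = 1) (n : ℕ) :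
    ∃ τ : Fin n → T, ∀ t, w t * n - 1 ≤ ((Finset.univ.filter fun v => τ v = t).card : ℝ) := by
  let m : T → ℕ := fun t => ⌊w t * n⌋₊
  have hm : ∑ t, m t ≤ n := by
    have h : ((∑ t, m t : ℕ) : ℝ) ≤ n := by
      push_cast
      calc ∑ t, (m t : ℝ) ≤ ∑ t, w t * n :=
            Finset.sum_le_sum fun t _ => Nat.floor_le (mul_nonneg (hw t) (Nat.cast_nonneg n))
        _ = n := by rw [← Finset.sum_mul, hsum, one_mul]
    exact_mod_cast h
  obtain ⟨e⟩ : Nonempty ((Σ t, Fin (m t)) ↪ Fin n) :=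
    Function.Embedding.nonempty_of_card_le (by simpa using hm)
  refine ⟨Function.extend e Sigma.fst fun _ => Classical.arbitrary T, fun t => ?_⟩
  have h1 : m t ≤ (Finset.univ.filter fun v =>
      Function.extend e Sigma.fst (fun _ => Classical.arbitrary T) v = t).card := by
    have := Finset.card_le_card_of_injOn (s := (Finset.univ : Finset (Fin (m t))))
      (t := Finset.univ.filter fun v =>
        Function.extend e Sigma.fst (fun _ => Classical.arbitrary T) v = t)
      (fun x => e ⟨t, x⟩)
      (fun x _ => by simp [e.injective.extend_apply])
      (e.injective.comp sigma_mk_injective).injOn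
    simpa using this
  have h2 : w t * n < m t + 1 := Nat.lt_floor_add_one _
  have h3 : (m t : ℝ) ≤ _ := Nat.cast_le.2 h1
  linarith

/-- Admissible profiles with densities `w` give rainbow-star-free collections: colour `i` joins every
vertex with out-colour `i` to every vertex with in-colour `i`. -/
theorem tightBound_of_profiles {T : Type*} [Fintype T] [DecidableEq T] [Nonempty T] {p q c : ℕ}
    (hc : 0 < c) (I O : T → Finset (Fin c)) (hadm : ∀ t, Admissible p q (I t) (O t))
    (w : T → ℝ) (hw : ∀ t, 0 ≤ w t) (hsum : ∑ t, w t = 1) (x y : ℝ)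
    (hx : ∀ i, ∑ t with i ∈ O t, w t = x) (hy : ∀ i, ∑ t with i ∈ I t, w t = y) :
    TightBound p q c (x * y) := by
  refine ⟨fun n => (2 * Fintype.card T + 1 : ℝ) * n, isLittleO_const_mul_natCast_sq _,
    fun n => ?_⟩
  obtain ⟨τ, hτ⟩ := exists_map_card_fiber_ge w hw hsum n
  let G : Fin c → Digraph (Fin n) := fun i =>
    { Adj := fun u v => u ≠ v ∧ i ∈ O (τ u) ∧ i ∈ I (τ v) }
  refine ⟨G, ⟨fun i v h => h.1 rfl, not_containsRainbow_star_of_admissible (fun v => I (τ v))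
    (fun v => O (τ v)) (fun v => hadm _) (fun i u v h => h.2.2) (fun i u v h => h.2.1)⟩, ?_⟩
  have : Nonempty (Fin c) := ⟨⟨0, hc⟩⟩
  obtain ⟨i, hi⟩ := exists_eq_ciInf_of_finite (f := fun i => edgeCount (G i))
  have hmin : minEdges G = edgeCount (G i) := hi.symm
  rw [hmin]
  have hclass : ∀ S : Finset T, (∑ t ∈ S, w t) * n - Fintype.card T ≤
      ((Finset.univ.filter fun v => τ v ∈ S).card : ℝ) := by
    intro S
    have h1 : (Finset.univ.filter fun v => τ v ∈ S).card =
        ∑ t ∈ S, (Finset.univ.filter fun v => τ v = t).card := by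
      rw [Finset.card_eq_sum_card_fiberwise (f := τ) (t := S) (fun v hv => by simpa using hv)]
      refine Finset.sum_congr rfl fun t ht => ?_
      congr 1
      ext v
      simp only [Finset.mem_filter, Finset.mem_univ, true_and, and_iff_right_iff_imp]
      rintro rfl
      exact ht
    rw [h1]
    push_cast
    have h2 : ∑ t ∈ S, (w t * n - 1) ≤
        ∑ t ∈ S, ((Finset.univ.filter fun v => τ v = t).card : ℝ) :=
      Finset.sum_le_sum fun t _ => hτ t
    rw [Finset.sum_sub_distrib, ← Finset.sum_mul] at h2
    have h3 : (S.card : ℝ) ≤ Fintype.card T := by exact_mod_cast S.card_le_univ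
    simp only [Finset.sum_const, nsmul_eq_mul, mul_one] at h2
    linarith
  let U : Finset (Fin n) := Finset.univ.filter fun v => i ∈ O (τ v)
  let W : Finset (Fin n) := Finset.univ.filter fun v => i ∈ I (τ v)
  have hU : x * n - Fintype.card T ≤ (U.card : ℝ) := by
    simpa [U, hx i] using hclass (Finset.univ.filter fun t => i ∈ O t)
  have hW : y * n - Fintype.card T ≤ (W.card : ℝ) := by
    simpa [W, hy i] using hclass (Finset.univ.filter fun t => i ∈ I t)
  have hUn : (U.card : ℝ) ≤ n := by exact_mod_cast (Finset.card_le_univ U).trans (by simp)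
  have hy0 : 0 ≤ y := hy i ▸ Finset.sum_nonneg fun t _ => hw t
  have hy1 : y ≤ 1 := by
    rw [← hy i, ← hsum]
    exact Finset.sum_le_sum_of_subset_of_nonneg (Finset.filter_subset _ _) fun t _ _ => hw t
  have hedges : U.card * W.card ≤ edgeCount (G i) + n := by
    have hsub : ((U ×ˢ W : Finset (Fin n × Fin n)) : Set (Fin n × Fin n)) ⊆
        edgeSet (G i) ∪ Set.range fun v : Fin n => (v, v) := by
      rintro ⟨u, v⟩ h
      have h' : i ∈ O (τ u) ∧ i ∈ I (τ v) := by simpa [U, W] using h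
      by_cases huv : u = v
      · exact Or.inr ⟨u, by rw [huv]⟩
      · exact Or.inl ⟨huv, h'⟩
    have h1 := Set.ncard_le_ncard hsub (Set.toFinite _)
    rw [Set.ncard_coe_finset, Finset.card_product] at h1
    have h2 : (Set.range fun v : Fin n => (v, v)).ncard ≤ n := by
      rw [← Set.image_univ]
      exact (Set.ncard_image_le Set.finite_univ).trans (by simp [Set.ncard_univ])
    exact h1.trans ((Set.ncard_union_le _ _).trans (Nat.add_le_add_left h2 _))
  have hedges' : (U.card : ℝ) * W.card ≤ edgeCount (G i) + n := by exact_mod_cast hedges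
  have hn : (0 : ℝ) ≤ n := Nat.cast_nonneg n
  have hT : (0 : ℝ) ≤ Fintype.card T := Nat.cast_nonneg _
  have hU0 : (0 : ℝ) ≤ U.card := Nat.cast_nonneg _
  -- With `N` classes, `|U| |W| ≥ |U| (y n - N) ≥ (x n - N) y n - N n ≥ x y n² - 2 N n`.
  have e1 := mul_le_mul_of_nonneg_left hW hU0
  have e2 := mul_le_mul_of_nonneg_right hU (mul_nonneg hy0 hn)
  have e3 := mul_le_mul_of_nonneg_right hUn hT
  have e4 := mul_le_mul_of_nonneg_right hy1 (mul_nonneg hT hn)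
  nlinarith

/-- The cyclic interval of `r` colours starting at `s`. -/
def cyclicInterval {c : ℕ} (r : ℕ) (s : Fin c) : Finset (Fin c) :=
  Finset.univ.filter fun i => (i - s).val < r

theorem card_filter_val_lt {c r : ℕ} (hr : r ≤ c) :
    (Finset.univ.filter fun x : Fin c => x.val < r).card = r := by
  rw [Fin.card_filter_val_lt, min_eq_right hr]

theorem card_cyclicInterval {c r : ℕ} (hr : r ≤ c) (s : Fin c) :
    (cyclicInterval r s).card = r := by
  have : NeZero c := ⟨by rintro rfl; exact s.elim0⟩
  conv_rhs => rw [← card_filter_val_lt hr]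
  exact Finset.card_equiv (Equiv.subRight s) (by simp [cyclicInterval])

theorem card_filter_mem_cyclicInterval {c r : ℕ} (hr : r ≤ c) (i : Fin c) :
    (Finset.univ.filter fun s : Fin c => i ∈ cyclicInterval r s).card = r := by
  have : NeZero c := ⟨by rintro rfl; exact i.elim0⟩
  conv_rhs => rw [← card_filter_val_lt hr]
  exact Finset.card_equiv (Equiv.subLeft i) (by simp [cyclicInterval])

/-- The three extreme profiles, each averaged over all cyclic shifts of its colour set, with total
weights `a`, `b` and `g`. -/
theorem tightBound_of_weights {p q c : ℕ} (hp : 1 ≤ p) (hq : 1 ≤ q) (hc : p + q ≤ c) {a b g : ℝ}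
    (ha : 0 ≤ a) (hb : 0 ≤ b) (hg : 0 ≤ g) (hsum : a + b + g = 1) :
    TightBound p q c ((a * c + b * (q - 1) + g * (p + q - 1)) / c *
      ((a * (p - 1) + b * c + g * (p + q - 1)) / c)) := by
  have hc0 : 0 < c := by omega
  have hc' : (c : ℝ) ≠ 0 := by exact_mod_cast hc0.ne'
  have : NeZero c := ⟨hc0.ne'⟩
  let I : Fin 3 × Fin c → Finset (Fin c) := fun t =>
    cyclicInterval (![p - 1, c, p + q - 1] t.1) t.2
  let O : Fin 3 × Fin c → Finset (Fin c) := fun t =>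
    cyclicInterval (![c, q - 1, p + q - 1] t.1) t.2
  have hkI : ∀ k, ![p - 1, c, p + q - 1] k ≤ c := by
    intro k; fin_cases k <;> simp <;> omega
  have hkO : ∀ k, ![c, q - 1, p + q - 1] k ≤ c := by
    intro k; fin_cases k <;> simp <;> omega
  have hweight : ∀ r : Fin 3 → ℕ, (∀ k, r k ≤ c) → ∀ i : Fin c,
      ∑ t : Fin 3 × Fin c with i ∈ cyclicInterval (r t.1) t.2, ![a, b, g] t.1 / c =
        (a * r 0 + b * r 1 + g * r 2) / c := by
    intro r hr i
    rw [Finset.sum_filter, Fintype.sum_prod_type]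
    have h : ∀ k : Fin 3, ∑ s : Fin c, (if i ∈ cyclicInterval (r k) s then ![a, b, g] k / c
        else 0) = ![a, b, g] k * r k / c := by
      intro k
      rw [← Finset.sum_filter, Finset.sum_const, card_filter_mem_cyclicInterval (hr k),
        nsmul_eq_mul]
      ring
    simp only [h, Fin.sum_univ_three]
    simp only [Matrix.cons_val_zero, Matrix.cons_val_one, Matrix.cons_val]
    ring
  refine tightBound_of_profiles hc0 I O ?_ (fun t => ![a, b, g] t.1 / c) ?_ ?_ _ _ ?_ ?_
  · rintro ⟨k, s⟩
    fin_cases k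
    · left
      simp only [I]
      rw [card_cyclicInterval (hkI _)]
      simp; omega
    · right; left
      simp only [O]
      rw [card_cyclicInterval (hkO _)]
      simp; omega
    · right; right
      have h : I ((2 : Fin 3), s) ∪ O ((2 : Fin 3), s) = cyclicInterval (p + q - 1) s := by
        simp [I, O]
      change (I ((2 : Fin 3), s) ∪ O ((2 : Fin 3), s)).card < p + q
      rw [h, card_cyclicInterval (by omega)]
      omega
  · rintro ⟨k, s⟩
    refine div_nonneg ?_ (Nat.cast_nonneg c)
    fin_cases k <;> simpa
  · rw [Fintype.sum_prod_type]
    simp only [Finset.sum_const, Finset.card_univ, Fintype.card_fin, nsmul_eq_mul,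
      Fin.sum_univ_three, Matrix.cons_val_zero, Matrix.cons_val_one, Matrix.cons_val]
    field_simp
    exact hsum
  · intro i
    refine (hweight _ hkO i).trans ?_
    simp only [Matrix.cons_val_zero, Matrix.cons_val_one, Matrix.cons_val]
    push_cast [Nat.cast_sub hq, Nat.cast_sub (by omega : 1 ≤ p + q)]
    ring
  · intro i
    refine (hweight _ hkI i).trans ?_
    simp only [Matrix.cons_val_zero, Matrix.cons_val_one, Matrix.cons_val]
    push_cast [Nat.cast_sub hp, Nat.cast_sub (by omega : 1 ≤ p + q)]
    ring

/-! ### The four regimes -/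

theorem asymptoticallyTight_bound₁ {p q c : ℕ} (hp : 1 ≤ p) (hpq : p ≤ q) (hc : p + q ≤ c)
    (h : (c : ℝ) ≤ 2 * p + q - 1) : AsymptoticallyTightBound p q c (bound₁ p q c) := by
  have hpq' : (p : ℝ) ≤ q := by exact_mod_cast hpq
  have hc0 : 0 < c := by omega
  have hc' : (c : ℝ) ≠ 0 := by exact_mod_cast hc0.ne'
  constructor
  · have hU := upperBound_of_linear_le (p := p) (q := q) hc0 (α := 1) (β := 1)
      (M := 2 * (p + q - 1)) one_pos one_pos (by linarith) (by linarith) (by linarith)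
    convert hU using 1
    rw [bound₁]
    field_simp
    ring
  · have hT := tightBound_of_weights hp (hp.trans hpq) hc (a := 0) (b := 0) (g := 1) le_rfl le_rfl
      zero_le_one (by norm_num)
    convert hT using 1
    rw [bound₁]
    field_simp
    ring

theorem asymptoticallyTight_bound₂ {p q c : ℕ} (hp : 1 ≤ p) (hpq : p ≤ q) (hc : p + q ≤ c)
    (h₁ : 2 * (p : ℝ) + q - 1 ≤ c) (h₂ : (c : ℝ) * (q - p - 1) ≤ (q - 1) * (p + q - 1))
    (h₃ : ((c : ℝ) - (p + q - 1)) ^ 2 ≤ p * q) :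
    AsymptoticallyTightBound p q c (bound₂ p q c) := by
  have hp' : (1 : ℝ) ≤ p := by exact_mod_cast hp
  have hpq' : (p : ℝ) ≤ q := by exact_mod_cast hpq
  have hcpq : (p : ℝ) + q ≤ c := by exact_mod_cast hc
  have hc0 : 0 < c := by omega
  have hc' : (0 : ℝ) < c := by exact_mod_cast hc0
  have hα : (0 : ℝ) < c - p - q + 1 := by linarith
  constructor
  · -- The line through the second and the third extreme profile.
    have hU := upperBound_of_linear_le (p := p) (q := q) hc0 (α := c - p - q + 1) (β := p)
      (M := (c - q + 1) * (p + q - 1)) hα (by linarith) (by nlinarith) (by nlinarith)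
      (by nlinarith)
    convert hU using 1
    rw [bound₂]
    field_simp
  · -- The weight at which `α x = β y` on this line.
    set b : ℝ := ((c - q + 1) * (p + q - 1) / (2 * p) - (p + q - 1)) / (c - p - q + 1) with hb
    have hb0 : 0 ≤ b := by
      refine div_nonneg ?_ hα.le
      rw [sub_nonneg, le_div_iff₀ (by linarith)]
      nlinarith
    have hb1 : b ≤ 1 := by
      rw [hb, div_le_one hα, sub_le_iff_le_add, div_le_iff₀ (by linarith)]
      nlinarith
    have hT := tightBound_of_weights hp (hp.trans hpq) hc (a := 0) (b := b) (g := 1 - b) le_rfl hb0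
      (by linarith) (by ring)
    have hbα : b * (c - p - q + 1) = (c - q + 1) * (p + q - 1) / (2 * p) - (p + q - 1) :=
      div_mul_cancel₀ _ hα.ne'
    have hy : 0 * ((p : ℝ) - 1) + b * c + (1 - b) * (p + q - 1) =
        (c - q + 1) * (p + q - 1) / (2 * p) := by linear_combination hbα
    have hx : 0 * (c : ℝ) + b * (q - 1) + (1 - b) * (p + q - 1) =
        (c - q + 1) * (p + q - 1) / (2 * (c - p - q + 1)) := by
      rw [hb]
      field_simp
      ring
    rw [hx, hy] at hT
    convert hT using 1
    rw [bound₂]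
    field_simp
    ring

theorem asymptoticallyTight_bound₃ {p q c : ℕ} (hp : 1 ≤ p) (hpq : p + 2 ≤ q) (hc : p + q ≤ c)
    (h₂ : ((q : ℝ) - 1) * (p + q - 1) ≤ c * (q - p - 1))
    (h₄ : ((c : ℝ) - (q - 1)) ^ 2 ≤ (q - 1) * (q - p)) :
    AsymptoticallyTightBound p q c (bound₃ q c) := by
  have hpq' : (p : ℝ) + 2 ≤ q := by exact_mod_cast hpq
  have hp' : (1 : ℝ) ≤ p := by exact_mod_cast hp
  have hc0 : 0 < c := by omega
  have hc' : (0 : ℝ) < c := by exact_mod_cast hc0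
  have hq' : (0 : ℝ) < q - 1 := by linarith
  constructor
  · -- The tangent to the hyperbola `x y = c (q - 1)` at the second extreme profile.
    have hU := upperBound_of_linear_le (p := p) (q := q) hc0 (α := c) (β := q - 1)
      (M := 2 * c * (q - 1)) hc' hq' (by nlinarith) (by nlinarith) (by nlinarith)
    convert hU using 1
    rw [bound₃]
    field_simp
    ring
  · have hT := tightBound_of_weights hp (by omega : 1 ≤ q) hc (a := 0) (b := 1) (g := 0) le_rfl
      zero_le_one le_rfl (by norm_num)
    convert hT using 1
    rw [bound₃]
    field_simp
    ring

theorem asymptoticallyTight_bound₄ {p q c : ℕ} (hp : 1 ≤ p) (hpq : p ≤ q) (hc : p + q ≤ c)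
    (h₃ : (p : ℝ) * q ≤ (c - (p + q - 1)) ^ 2)
    (h₄ : ((q : ℝ) - 1) * (q - p) ≤ (c - (q - 1)) ^ 2) :
    AsymptoticallyTightBound p q c (bound₄ p q c) := by
  have hp' : (1 : ℝ) ≤ p := by exact_mod_cast hp
  have hpq' : (p : ℝ) ≤ q := by exact_mod_cast hpq
  have hcpq : (p : ℝ) + q ≤ c := by exact_mod_cast hc
  have hc0 : 0 < c := by omega
  have hc' : (0 : ℝ) < c := by exact_mod_cast hc0
  have hα : (0 : ℝ) < c - p + 1 := by linarith
  have hβ : (0 : ℝ) < c - q + 1 := by linarith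
  set M : ℝ := (c : ℝ) ^ 2 - (p - 1) * (q - 1) with hM
  constructor
  · -- The line through the first and the second extreme profile.
    have hU := upperBound_of_linear_le (p := p) (q := q) hc0 (α := c - p + 1) (β := c - q + 1)
      (M := M) hα hβ (by nlinarith) (by nlinarith) (by nlinarith)
    convert hU using 1
    rw [bound₄, ← hM]
    field_simp
  · -- The weight at which `α x = β y` on this line.
    set a : ℝ := (c - M / (2 * (c - q + 1))) / (c - p + 1) with ha
    have ha0 : 0 ≤ a := by
      refine div_nonneg ?_ hα.le
      rw [sub_nonneg, div_le_iff₀ (by linarith)]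
      nlinarith
    have haα : a * (c - p + 1) = c - M / (2 * (c - q + 1)) := div_mul_cancel₀ _ hα.ne'
    have hy : a * ((p : ℝ) - 1) + (1 - a) * c + 0 * (p + q - 1) = M / (2 * (c - q + 1)) := by
      linear_combination -haα
    have hx : a * (c : ℝ) + (1 - a) * (q - 1) + 0 * (p + q - 1) = M / (2 * (c - p + 1)) := by
      rw [ha, hM]
      field_simp
      ring
    have ha1 : a ≤ 1 := by
      have h : M / (2 * (c - p + 1)) ≤ c := by
        rw [div_le_iff₀ (by linarith)]
        nlinarith [sq_nonneg ((c : ℝ) - (p - 1)), mul_nonneg (sub_nonneg.2 hp')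
          (sub_nonneg.2 hpq')]
      nlinarith
    have hT := tightBound_of_weights hp (hp.trans hpq) hc (a := a) (b := 1 - a) (g := 0) ha0
      (by linarith) le_rfl (by ring)
    rw [hx, hy] at hT
    convert hT using 1
    rw [bound₄, ← hM]
    field_simp
    norm_num

/-! ### The thresholds -/

theorem t₁_le_t₂ {p q : ℕ} : t₁ p q ≤ t₂ p q := by
  rw [t₁, t₂]
  split_ifs with h
  · have h' : (p : ℝ) + 2 ≤ q := by exact_mod_cast h
    rw [EReal.coe_le_coe_iff, le_div_iff₀ (by linarith)]
    nlinarith [sq_nonneg (p : ℝ)]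
  · exact le_top

theorem t₁_le_t₃ {p q : ℕ} (hpq : p ≤ q) : t₁ p q ≤ t₃ p q := by
  have hpq' : (p : ℝ) ≤ q := by exact_mod_cast hpq
  have h : (p : ℝ) ≤ √((p : ℝ) * q) := by
    apply Real.le_sqrt_of_sq_le
    nlinarith [(Nat.cast_nonneg p : (0 : ℝ) ≤ p)]
  rw [t₁, t₃, EReal.coe_le_coe_iff]
  linarith

theorem natCast_le_t₁_iff {p q c : ℕ} : (c : EReal) ≤ t₁ p q ↔ (c : ℝ) ≤ 2 * p + q - 1 := by
  rw [t₁, ← EReal.coe_natCast, EReal.coe_le_coe_iff]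

theorem t₁_le_natCast_iff {p q c : ℕ} : t₁ p q ≤ (c : EReal) ↔ 2 * (p : ℝ) + q - 1 ≤ c := by
  rw [t₁, ← EReal.coe_natCast, EReal.coe_le_coe_iff]

theorem natCast_le_t₂ {p q c : ℕ} (hp : 1 ≤ p) (hpq : p ≤ q) (h : (c : EReal) ≤ t₂ p q) :
    (c : ℝ) * (q - p - 1) ≤ (q - 1) * (p + q - 1) := by
  rw [t₂, ← EReal.coe_natCast] at h
  split_ifs at h with hq
  · have hq' : (p : ℝ) + 2 ≤ q := by exact_mod_cast hq
    rwa [EReal.coe_le_coe_iff, le_div_iff₀ (by linarith)] at h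
  · have hq' : (q : ℝ) ≤ p + 1 := by exact_mod_cast (by omega : q ≤ p + 1)
    have hp' : (1 : ℝ) ≤ p := by exact_mod_cast hp
    have hpq' : (p : ℝ) ≤ q := by exact_mod_cast hpq
    exact (mul_nonpos_of_nonneg_of_nonpos (Nat.cast_nonneg c) (by linarith)).trans
      (mul_nonneg (by linarith) (by linarith))

theorem t₂_le_natCast {p q c : ℕ} (h : t₂ p q ≤ (c : EReal)) :
    p + 2 ≤ q ∧ ((q : ℝ) - 1) * (p + q - 1) ≤ c * (q - p - 1) := by
  rw [t₂, ← EReal.coe_natCast] at h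
  split_ifs at h with hq
  · have hq' : (p : ℝ) + 2 ≤ q := by exact_mod_cast hq
    rw [EReal.coe_le_coe_iff, div_le_iff₀ (by linarith)] at h
    exact ⟨hq, h⟩
  · exact absurd h (not_le.2 (EReal.coe_lt_top _))

theorem natCast_le_t₃ {p q c : ℕ} (hc : p + q ≤ c) (h : (c : EReal) ≤ t₃ p q) :
    ((c : ℝ) - (p + q - 1)) ^ 2 ≤ p * q := by
  have hc' : (p : ℝ) + q ≤ c := by exact_mod_cast hc
  rw [t₃, ← EReal.coe_natCast, EReal.coe_le_coe_iff] at h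
  exact (Real.le_sqrt (by linarith) (by positivity)).1 (by linarith)

theorem t₃_le_natCast {p q c : ℕ} (h : t₃ p q ≤ (c : EReal)) :
    (p : ℝ) * q ≤ (c - (p + q - 1)) ^ 2 := by
  rw [t₃, ← EReal.coe_natCast, EReal.coe_le_coe_iff] at h
  exact Real.sqrt_le_left (by linarith [Real.sqrt_nonneg ((p : ℝ) * q)]) |>.1 (by linarith)

theorem natCast_le_t₄ {p q c : ℕ} (hp : 1 ≤ p) (hpq : p ≤ q) (hc : p + q ≤ c)
    (h : (c : EReal) ≤ t₄ p q) :
    ((c : ℝ) - (q - 1)) ^ 2 ≤ (q - 1) * (q - p) := by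
  have hp' : (1 : ℝ) ≤ p := by exact_mod_cast hp
  have hpq' : (p : ℝ) ≤ q := by exact_mod_cast hpq
  have hc' : (p : ℝ) + q ≤ c := by exact_mod_cast hc
  rw [t₄, ← EReal.coe_natCast, EReal.coe_le_coe_iff] at h
  exact (Real.le_sqrt (by linarith) (mul_nonneg (by linarith) (by linarith))).1 (by linarith)

theorem t₄_le_natCast {p q c : ℕ} (h : t₄ p q ≤ (c : EReal)) :
    ((q : ℝ) - 1) * (q - p) ≤ (c - (q - 1)) ^ 2 := by
  rw [t₄, ← EReal.coe_natCast, EReal.coe_le_coe_iff] at h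
  exact Real.sqrt_le_left (by linarith [Real.sqrt_nonneg (((q : ℝ) - 1) * (q - p))]) |>.1
    (by linarith)

/-- Let `s = √p` and `u = √q`. Once denominators and the remaining square root are cleared, the
comparison of `t₂` with `t₃` and that of `t₃` with `t₄` have the common factor
`u³ - s u² - s² u - s³ - u + s`, with positive cofactors `s` and `u + s`. -/
theorem t₂_t₃_t₄_ordered {p q : ℕ} (hp : 1 ≤ p) (hpq : p ≤ q) :
    (t₂ p q ≤ t₃ p q ∧ t₃ p q ≤ t₄ p q) ∨ (t₄ p q ≤ t₃ p q ∧ t₃ p q ≤ t₂ p q) := by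
  have hp' : (1 : ℝ) ≤ p := by exact_mod_cast hp
  have hpq' : (p : ℝ) ≤ q := by exact_mod_cast hpq
  obtain ⟨s, hs0, hs⟩ : ∃ s : ℝ, 0 < s ∧ (p : ℝ) = s ^ 2 :=
    ⟨√p, Real.sqrt_pos.2 (by linarith), (Real.sq_sqrt (by linarith)).symm⟩
  obtain ⟨u, hu0, hu⟩ : ∃ u : ℝ, 0 < u ∧ (q : ℝ) = u ^ 2 :=
    ⟨√q, Real.sqrt_pos.2 (by linarith), (Real.sq_sqrt (by linarith)).symm⟩
  have hsu : √((p : ℝ) * q) = s * u := by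
    rw [hs, hu, ← mul_pow, Real.sqrt_sq (by positivity)]
  have hnn : 0 ≤ ((q : ℝ) - 1) * (q - p) := mul_nonneg (by linarith) (by linarith)
  by_cases hq : p + 2 ≤ q
  · have hq' : (p : ℝ) + 2 ≤ q := by exact_mod_cast hq
    simp only [t₂, t₃, t₄, if_pos hq, EReal.coe_le_coe_iff, hsu]
    rw [hs, hu] at *
    rcases le_total 0 (u ^ 3 - s * u ^ 2 - s ^ 2 * u - s ^ 3 - u + s) with h | h
    · left
      constructor
      · rw [div_le_iff₀ (by linarith)]
        nlinarith [mul_nonneg hs0.le h]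
      · have : s ^ 2 + s * u ≤ √((u ^ 2 - 1) * (u ^ 2 - s ^ 2)) := by
          apply Real.le_sqrt_of_sq_le
          nlinarith [mul_nonneg (add_pos hu0 hs0).le h]
        linarith
    · right
      constructor
      · have : √((u ^ 2 - 1) * (u ^ 2 - s ^ 2)) ≤ s ^ 2 + s * u := by
          apply Real.sqrt_le_iff.2 ⟨by positivity, ?_⟩
          nlinarith [mul_nonneg (add_pos hu0 hs0).le (neg_nonneg.2 h)]
        linarith
      · rw [le_div_iff₀ (by linarith)]
        nlinarith [mul_nonneg hs0.le (neg_nonneg.2 h)]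
  · right
    have hq' : (q : ℝ) ≤ p + 1 := by exact_mod_cast (by omega : q ≤ p + 1)
    refine ⟨?_, by simp [t₂, if_neg hq]⟩
    simp only [t₃, t₄, EReal.coe_le_coe_iff]
    have h : √(((q : ℝ) - 1) * (q - p)) ≤ p := by
      apply Real.sqrt_le_iff.2 ⟨by linarith, ?_⟩
      nlinarith
    linarith [Real.sqrt_nonneg ((p : ℝ) * q)]

end RainbowStar

theorem mainTheorem4 (p q c : ℕ) (hp : 1 ≤ p) (hpq : p ≤ q) (hc : p + q ≤ c) :
    RainbowStar.t₁ p q ≤ RainbowStar.t₂ p q ∧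
    RainbowStar.t₁ p q ≤ RainbowStar.t₃ p q ∧
    ((RainbowStar.t₂ p q ≤ RainbowStar.t₃ p q ∧ RainbowStar.t₃ p q ≤ RainbowStar.t₄ p q) ∨
      (RainbowStar.t₄ p q ≤ RainbowStar.t₃ p q ∧ RainbowStar.t₃ p q ≤ RainbowStar.t₂ p q)) ∧
    (RainbowStar.t₂ p q ≤ RainbowStar.t₃ p q ∧ RainbowStar.t₃ p q ≤ RainbowStar.t₄ p q →
      ((c : EReal) ≤ RainbowStar.t₁ p q →
        RainbowStar.AsymptoticallyTightBound p q c (RainbowStar.bound₁ p q c)) ∧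
      (RainbowStar.t₁ p q ≤ (c : EReal) ∧ (c : EReal) ≤ RainbowStar.t₂ p q →
        RainbowStar.AsymptoticallyTightBound p q c (RainbowStar.bound₂ p q c)) ∧
      (RainbowStar.t₂ p q ≤ (c : EReal) ∧ (c : EReal) ≤ RainbowStar.t₄ p q →
        RainbowStar.AsymptoticallyTightBound p q c (RainbowStar.bound₃ q c)) ∧
      (RainbowStar.t₄ p q ≤ (c : EReal) →
        RainbowStar.AsymptoticallyTightBound p q c (RainbowStar.bound₄ p q c))) ∧
    (RainbowStar.t₄ p q ≤ RainbowStar.t₃ p q ∧ RainbowStar.t₃ p q ≤ RainbowStar.t₂ p q →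
      ((c : EReal) ≤ RainbowStar.t₁ p q →
        RainbowStar.AsymptoticallyTightBound p q c (RainbowStar.bound₁ p q c)) ∧
      (RainbowStar.t₁ p q ≤ (c : EReal) ∧ (c : EReal) ≤ RainbowStar.t₃ p q →
        RainbowStar.AsymptoticallyTightBound p q c (RainbowStar.bound₂ p q c)) ∧
      (RainbowStar.t₃ p q ≤ (c : EReal) →
        RainbowStar.AsymptoticallyTightBound p q c (RainbowStar.bound₄ p q c))) := by
  refine ⟨RainbowStar.t₁_le_t₂, RainbowStar.t₁_le_t₃ hpq,
    RainbowStar.t₂_t₃_t₄_ordered hp hpq, ?_, ?_⟩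
  · rintro ⟨h23, h34⟩
    refine ⟨fun h => ?_, fun ⟨h1, h2⟩ => ?_, fun ⟨h2, h4⟩ => ?_, fun h4 => ?_⟩
    · exact RainbowStar.asymptoticallyTight_bound₁ hp hpq hc (RainbowStar.natCast_le_t₁_iff.1 h)
    · exact RainbowStar.asymptoticallyTight_bound₂ hp hpq hc (RainbowStar.t₁_le_natCast_iff.1 h1)
        (RainbowStar.natCast_le_t₂ hp hpq h2) (RainbowStar.natCast_le_t₃ hc (h2.trans h23))
    · obtain ⟨hq, h2'⟩ := RainbowStar.t₂_le_natCast h2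
      exact RainbowStar.asymptoticallyTight_bound₃ hp hq hc h2'
        (RainbowStar.natCast_le_t₄ hp hpq hc h4)
    · exact RainbowStar.asymptoticallyTight_bound₄ hp hpq hc
        (RainbowStar.t₃_le_natCast (h34.trans h4)) (RainbowStar.t₄_le_natCast h4)
  · rintro ⟨h43, h32⟩
    refine ⟨fun h => ?_, fun ⟨h1, h3⟩ => ?_, fun h3 => ?_⟩
    · exact RainbowStar.asymptoticallyTight_bound₁ hp hpq hc (RainbowStar.natCast_le_t₁_iff.1 h)
    · exact RainbowStar.asymptoticallyTight_bound₂ hp hpq hc (RainbowStar.t₁_le_natCast_iff.1 h1)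
        (RainbowStar.natCast_le_t₂ hp hpq (h3.trans h32)) (RainbowStar.natCast_le_t₃ hc h3)
    · exact RainbowStar.asymptoticallyTight_bound₄ hp hpq hc (RainbowStar.t₃_le_natCast h3)
        (RainbowStar.t₄_le_natCast (h43.trans h3))
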